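/- Let $V$ be a finite set. **Graphs.** Graphs have node set $V$, no loops, at most one edge between two nodes, and edges that are arrows $i\to j$ or arcs $i\leftrightarrow j$; the skeleton $\mathrm{sk}(G)$ is obtained by removing all arrowheads. Node $a$ is an ancestor of $b$ if there is a directed path with at least one arrow from $a$ to $b$. All graphs are *directed ancestral graphs*: there is no directed cycle, and no endpoint of an arc is an ancestor of the other endpoint. A DAG is such a graph without arcs. The inner node $t$ of a three-node path $\langle x,t,y\rangle$ is a collider if both of its edges have an arrowhead at $t$. A path (without repeated nodes) is *connecting* given $C$ if each collider node on it is in $C$ or an ancestor of a node of $C$, and no inner non-collider node on it is in $C$. For pairwise disjoint $A,B,C\subseteq V$, $A$ and $B$ are *separated* given $C$ if no path between a node of $A$ and a node of $B$ is connecting given $C$; $\mathcal J(G)$ is the set of all such separated triples $\langle A,B\,|\,C\rangle$. $G$ and $H$ are *Markov equivalent* if $\mathcal J(G)=\mathcal J(H)$. $G$ is *maximal* if for any distinct non-adjacent $i,j$ there is $C\subseteq V\setminus\{i,j\}$ with $\langle i,j\,|\,C\rangle\in\mathcal J(G)$. The *minimal order* of $G$ is the strict partial order in which $j<i$ if and only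 if $i$ is an ancestor of $j$. **Independence models.** An independence model $\mathcal J$ over $V$ is a set of triples $\langle A,B\,|\,C\rangle$ of pairwise disjoint subsets of $V$ containing all triples with $A=\varnothing$ or $B=\varnothing$. The main example is $\mathcal J(P)$, for a joint probability distribution $P$ of $(X_v)_{v\in V}$: the set of all pairwise disjoint $\langle A,B\,|\,C\rangle$ such that $X_A$ is conditionally independent of $X_B$ given $X_C$. The skeleton $\mathrm{sk}(\mathcal J)$ is the undirected graph on $V$ in which distinct $i,j$ are joined, $i\sim j$, unless $\langle i,j\,|\,C\rangle\in\mathcal J$ for some $C\subseteq V\setminus\{i,j\}$ (if $\mathcal J$ is not symmetric: unless there is such a set for $(i,j)$ and one for $(j,i)$). $\mathcal J$ satisfies *ordered stability* with respect to $G$ if, for the minimal order $<$ of $G$, whenever $\langle i,j\,|\,C\rangle\in\mathcal J$ and $k\in V\setminus\{i,j\}$: * if $i<k$ or $j<k$, then $\langle i,j\,|\,C\cup\{k\}\rangle\in\mathcal J$; * if $i\nless k$, $j\nless k$, and $l\nless k$ for all $l\in C\setminus\{k\}$, then $\langle i,j\,|\,C\setminus\{k\}\rangle\in\mathcal J$.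 $\mathcal J$ is *path-stable* if there do **not** exist $r\ge 0$, a path $\langle i,i_1,\dots,i_r,k,j\rangle$ in $\mathrm{sk}(\mathcal J)$ with $i\not\sim j$ and $i_n\sim j$ for all $1\le n\le r$, and a set $C$ disjoint from $\{i,j,k\}$, such that, with $U=\{i_1,\dots,i_r\}$, both $\langle i,j\,|\,U\cup C\rangle\in\mathcal J$ and $\langle i,j\,|\,U\cup C\cup\{k\}\rangle\in\mathcal J$. It is *V-stable* if this does not happen with $r=0$. **Proposition.** For every independence model $\mathcal J$ over $V$, and in particular for $\mathcal J=\mathcal J(P)$ for every probability distribution $P$: (a) if $\mathcal J$ is path-stable, then it has the *uniqueness property*: any two maximal directed ancestral graphs with skeleton $\mathrm{sk}(\mathcal J)$ with respect to which $\mathcal J$ satisfies ordered stability are Markov equivalent; (b) if $\mathcal J$ is V-stable, then it has the *DAG-uniqueness property*: any two maximal DAGs with skeleton $\mathrm{sk}(\mathcal J)$ with respect to which $\mathcal J$ satisfies ordered stability are Markov equivalent. -/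

import Mathlib

/-! ### Directed ancestral graphs -/

/-- A simple graph whose edges are arrows `i → j` (`arrow i j`) and bidirected edges
`i ↔ j` (`arc i j`), with at most one edge between any two nodes and no loops. -/
structure MixedGraph (V : Type*) where
  arrow : V → V → Prop
  arc : V → V → Prop
  arc_symm : ∀ i j, arc i j → arc j i
  arrow_irrefl : ∀ i, ¬ arrow i i
  arc_irrefl : ∀ i, ¬ arc i i
  arrow_asymm : ∀ i j, arrow i j → ¬ arrow j i
  arrow_not_arc : ∀ i j, arrow i j → ¬ arc i j

namespace MixedGraph

variable {V : Type*} (G : MixedGraph V)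

/-- The skeleton of a graph. -/
def skeleton : SimpleGraph V where
  Adj i j := G.arrow i j ∨ G.arrow j i ∨ G.arc i j
  symm := ⟨fun i j h => by
    rcases h with h | h | h
    · exact Or.inr (Or.inl h)
    · exact Or.inl h
    · exact Or.inr (Or.inr (G.arc_symm i j h))⟩
  loopless := ⟨fun i h => by
    rcases h with h | h | h
    · exact G.arrow_irrefl i h
    · exact G.arrow_irrefl i h
    · exact G.arc_irrefl i h⟩

/-- `G.Anc a b`: there is a directed path (with at least one arrow) from `a` to `b`, that is,
`a` is an ancestor of `b`. -/
def Anc (a b : V) : Prop := Relation.TransGen G.arrow a b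

/-- There is an edge between `x` and `y` with an arrowhead at `y`. -/
def HeadAt (x y : V) : Prop := G.arrow x y ∨ G.arc x y

/-- The inner node `y` of the tripath `⟨x, y, z⟩` is a collider. -/
def IsCollider (x y z : V) : Prop := G.HeadAt x y ∧ G.HeadAt z y

/-- A path `p` is connecting given `C` if every collider node on it is in `C` or an ancestor of
a node of `C`, and every (inner) non-collider node on it is outside `C`. -/
def Connecting (C : Set V) {a b : V} (p : G.skeleton.Walk a b) : Prop :=
  p.IsPath ∧ ∀ x y z : V, [x, y, z] <:+: p.support →
    (G.IsCollider x y z → y ∈ C ∨ ∃ c ∈ C, G.Anc y c) ∧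
    (¬ G.IsCollider x y z → y ∉ C)

/-- `A` and `B` are separated given `C`. -/
def Separated (A B C : Set V) : Prop :=
  ∀ a ∈ A, ∀ b ∈ B, ∀ p : G.skeleton.Walk a b, ¬ G.Connecting C p

end MixedGraph

/-- A directed ancestral graph: no directed cycle, and no arc one of whose endpoints is an
ancestor of the other. -/
structure DirectedAncestralGraph (V : Type*) extends MixedGraph V where
  acyclic : ∀ i, ¬ toMixedGraph.Anc i i
  ancestral : ∀ i j, arc i j → ¬ toMixedGraph.Anc i j

/-! ### Independence models -/

/-- An independence model over `V`: a set of triples of pairwise disjoint subsets of `V`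
containing all statements in which one of the first two sets is empty. `Indep A B C` means that
`⟨A, B | C⟩` belongs to the model. -/
@[ext]
structure IndependenceModel (V : Type*) where
  Indep : Set V → Set V → Set V → Prop
  disjoint : ∀ A B C, Indep A B C → Disjoint A B ∧ Disjoint A C ∧ Disjoint B C
  empty_left : ∀ B C, Disjoint B C → Indep ∅ B C
  empty_right : ∀ A C, Disjoint A C → Indep A ∅ C

namespace MixedGraph

/-- The independence model induced by a graph through separation. -/
def indepModel {V : Type*} (G : MixedGraph V) : IndependenceModel V where
  Indep A B C := (Disjoint A B ∧ Disjoint A C ∧ Disjoint B C) ∧ G.Separated A B C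
  disjoint _ _ _ h := h.1
  empty_left _ _ h := ⟨by simp [h], fun _ ha => absurd ha (Set.notMem_empty _)⟩
  empty_right _ _ h := ⟨by simp [h], fun _ _ _ hb => absurd hb (Set.notMem_empty _)⟩

/-- Two graphs are Markov equivalent if they induce the same independence model. -/
def MarkovEquivalent {V : Type*} (G H : MixedGraph V) : Prop := G.indepModel = H.indepModel

/-- A graph is maximal if any two distinct non-adjacent nodes `i`, `j` are separated by some
`C`. (That `C` contains neither `i` nor `j` is part of `indepModel`.) -/
def IsMaximal {V : Type*} (G : MixedGraph V) : Prop :=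
  ∀ i j : V, i ≠ j → ¬ G.skeleton.Adj i j → ∃ C : Set V, G.indepModel.Indep {i} {j} C

end MixedGraph

namespace DirectedAncestralGraph

/-- A directed acyclic graph: a directed ancestral graph with arrows only. -/
def IsDAG {V : Type*} (G : DirectedAncestralGraph V) : Prop := ∀ i j, ¬ G.arc i j

/-- The minimal order of a directed ancestral graph: the partial order generated by `i > j`
for each arrow `i → j`; so `j < i` if and only if `i` is an ancestor of `j`. -/
@[reducible]
def minimalOrder {V : Type*} (G : DirectedAncestralGraph V) : PartialOrder V where
  le j i := j = i ∨ G.Anc i j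
  lt j i := G.Anc i j
  le_refl _ := Or.inl rfl
  le_trans a b c hab hbc := by
    rcases hab with rfl | hab
    · exact hbc
    · rcases hbc with rfl | hbc
      · exact Or.inr hab
      · exact Or.inr (Relation.TransGen.trans hbc hab)
  lt_iff_le_not_ge a b := by
    constructor
    · intro h
      refine ⟨Or.inr h, ?_⟩
      rintro (rfl | h')
      · exact G.acyclic _ h
      · exact G.acyclic _ (Relation.TransGen.trans h' h)
    · rintro ⟨rfl | h, h'⟩
      · exact absurd (Or.inl rfl) h'
      · exact h
  le_antisymm a b hab hba := by
    rcases hab with rfl | hab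
    · rfl
    · rcases hba with rfl | hba
      · rfl
      · exact absurd (Relation.TransGen.trans hba hab) (G.acyclic _)

end DirectedAncestralGraph

namespace IndependenceModel

variable {V : Type*} (J : IndependenceModel V)

/-- The skeleton of an independence model: for all distinct nodes `i`, `j` an edge is drawn
unless `⟨i, j | C⟩ ∈ J` for some `C ⊆ V ∖ {i, j}`. (For a model that is not symmetric the edge is
left out only if such a `C` exists for `(i, j)` and for `(j, i)`.) -/
def skeleton : SimpleGraph V :=
  SimpleGraph.fromRel fun i j => ¬ ∃ C : Set V, i ∉ C ∧ j ∉ C ∧ J.Indep {i} {j} C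

/-- Ordered upward-stability with respect to a partial order. -/
def OrderedUpwardStable (o : PartialOrder V) : Prop :=
  ∀ (i j : V) (C : Set V), J.Indep {i} {j} C →
    ∀ k, k ≠ i → k ≠ j → (o.lt i k ∨ o.lt j k) → J.Indep {i} {j} (C ∪ {k})

/-- Ordered downward-stability with respect to a partial order. -/
def OrderedDownwardStable (o : PartialOrder V) : Prop :=
  ∀ (i j : V) (C : Set V), J.Indep {i} {j} C →
    ∀ k, k ≠ i → k ≠ j → ¬ o.lt i k → ¬ o.lt j k → (∀ l ∈ C \ {k}, ¬ o.lt l k) →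
      J.Indep {i} {j} (C \ {k})

/-- Ordered stability with respect to a graph, that is, with respect to its minimal order. -/
def OrderedStableWrt (G : DirectedAncestralGraph V) : Prop :=
  J.OrderedUpwardStable G.minimalOrder ∧ J.OrderedDownwardStable G.minimalOrder

/-- Path-instability. The path is `⟨i, i₁, …, i_r, k, j⟩`, with `us = [i₁, …, i_r]`
(`r = 0` being allowed) and `U = {i₁, …, i_r}`. -/
def PathUnstable : Prop :=
  ∃ (i k j : V) (us : List V) (p : J.skeleton.Walk i j),
    p.IsPath ∧ p.support = i :: (us ++ [k, j]) ∧
    ¬ J.skeleton.Adj i j ∧ (∀ u ∈ us, J.skeleton.Adj u j) ∧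
    ∃ C : Set V, i ∉ C ∧ j ∉ C ∧ k ∉ C ∧
      J.Indep {i} {j} ({u | u ∈ us} ∪ C) ∧ J.Indep {i} {j} ({u | u ∈ us} ∪ C ∪ {k})

/-- Path-stability. -/
def PathStable : Prop := ¬ J.PathUnstable

/-- V-instability, `⟨i, k, j⟩` being a V-configuration (a path on three nodes with non-adjacent
endpoints) of the skeleton. -/
def VUnstable : Prop :=
  ∃ i k j : V, i ≠ j ∧ J.skeleton.Adj i k ∧ J.skeleton.Adj k j ∧ ¬ J.skeleton.Adj i j ∧
    ∃ C : Set V, i ∉ C ∧ j ∉ C ∧ k ∉ C ∧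
      J.Indep {i} {j} C ∧ J.Indep {i} {j} (C ∪ {k})

/-- V-stability. -/
def VStable : Prop := ¬ J.VUnstable

/-- The uniqueness property: all maximal graphs with the skeleton of `J` with respect to which
`J` satisfies ordered stability are Markov equivalent. -/
def UniquenessProperty : Prop :=
  ∀ G H : DirectedAncestralGraph V,
    G.IsMaximal → G.skeleton = J.skeleton → J.OrderedStableWrt G →
    H.IsMaximal → H.skeleton = J.skeleton → J.OrderedStableWrt H →
    G.MarkovEquivalent H.toMixedGraph

/-- The DAG-uniqueness property: the uniqueness property restricted to DAGs. -/
def DAGUniquenessProperty : Prop :=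
  ∀ G H : DirectedAncestralGraph V, G.IsDAG → H.IsDAG →
    G.IsMaximal → G.skeleton = J.skeleton → J.OrderedStableWrt G →
    H.IsMaximal → H.skeleton = J.skeleton → J.OrderedStableWrt H →
    G.MarkovEquivalent H.toMixedGraph

end IndependenceModel

/-! ### The independence model of a distribution -/

section Probability

open MeasureTheory

variable {V : Type*} {X : V → Type*} [∀ v, MeasurableSpace (X v)]

/-- The σ-algebra generated by the subvector `X_A` of coordinates in `A`. -/
@[reducible]
def coordSigma (X : V → Type*) [∀ v, MeasurableSpace (X v)] (A : Set V) :
    MeasurableSpace (∀ v, X v) :=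
  MeasurableSpace.comap A.domRestrict MeasurableSpace.pi

/-- `X_A` is conditionally independent of `X_B` given `X_C` under the joint distribution `P`: for
every measurable set `S` of values of `X_A`,
`P(X_A ∈ S | X_B, X_C) = P(X_A ∈ S | X_C)` almost surely. -/
def CondIndepCoord (P : Measure (∀ v, X v)) (A B C : Set V) : Prop :=
  ∀ S : Set (∀ v : A, X v), MeasurableSet S →
    P[(A.domRestrict ⁻¹' S).indicator (fun _ => (1 : ℝ)) | coordSigma X (B ∪ C)] =ᵐ[P]
      P[(A.domRestrict ⁻¹' S).indicator (fun _ => (1 : ℝ)) | coordSigma X C]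

lemma coordSigma_le (A : Set V) : coordSigma X A ≤ MeasurableSpace.pi :=
  (Set.measurable_restrict A).comap_le

/-- The independence model induced by a joint distribution. -/
def distributionModel (P : Measure (∀ v, X v)) [IsProbabilityMeasure P] :
    IndependenceModel V where
  Indep A B C := (Disjoint A B ∧ Disjoint A C ∧ Disjoint B C) ∧ CondIndepCoord P A B C
  disjoint _ _ _ h := h.1
  empty_left B C h := by
    refine ⟨by simp [h], fun S _ => ?_⟩
    have hS : ∃ c : ℝ, ((∅ : Set V).domRestrict ⁻¹' S).indicator (fun _ : ∀ v, X v => (1 : ℝ)) =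
        fun _ => c := by
      rcases Set.eq_empty_or_nonempty S with rfl | ⟨s, hs⟩
      · exact ⟨0, by simp⟩
      · refine ⟨1, ?_⟩
        funext x
        have hx : (∅ : Set V).domRestrict x = s := Subsingleton.elim _ _
        simp [Set.indicator, hx, hs]
    obtain ⟨c, hc⟩ := hS
    rw [hc, condExp_const (coordSigma_le _), condExp_const (coordSigma_le _)]
  empty_right A C h := by
    refine ⟨by simp [h], fun S _ => ?_⟩
    rw [Set.empty_union]

end Probability

/-! ### Connecting sequences -/

namespace MixedGraph

variable {V : Type*} (G : MixedGraph V)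

/-! Both parts rest on a graphical criterion (`markovEquivalent_of_sameDiscriminated`): for maximal
G and H with the same skeleton, it suffices to agree on the last inner node of every path that is
discriminating in both, unshielded triples included (`SameDiscriminated`).

Stability supplies the agreement. Let q 0, …, q n, j be such a path, with q n a collider in G only.
Ordered stability with respect to G yields ⟨q 0, j | A⟩, where A is the set of G-ancestors of q 0
and j other than these two nodes. The parents q 1, …, q (n - 1) of j lie in A; q n does not, since
otherwise the path would be inducing and maximality would join its endpoints. In H, q n is an
ancestor of q 0 or j, so upward stability with respect to H adds q n to A. This is path-instability,
and V-instability if n = 1. In DAGs with n > 1, q n is never a collider.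

For the criterion, take a connecting sequence of least total rank between fixed endpoints.
Connecting shortcuts, and connecting replacements of a stretch by a child of one of its nodes, would
lower the weight. So the sequence is a path, and its shielded triples are discriminated from the
left or the right (`exists_discriminates`). If H disagreed about its colliders, disagreements would
propagate along discriminating paths until two of these cross, which `Discriminates.not_crossing`
forbids. Colliders also stay active in H (`inAn_of_isMinConn`): on a shortest directed path of G to
Z, either the first arrow survives in H, and then so does the path, or its head could replace the
collider at lower weight. Hence H connects the same endpoints, and symmetry finishes. -/

/-- `v` is in `Z` or an ancestor of a node of `Z`. -/
def InAn (Z : Set V) (v : V) : Prop := v ∈ Z ∨ ∃ z ∈ Z, G.Anc v z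

/-- The inner node `b` of the tripath `⟨a, b, c⟩` does not block a path given `Z`. -/
def Active (Z : Set V) (a b c : V) : Prop :=
  (G.IsCollider a b c → G.InAn Z b) ∧ (¬ G.IsCollider a b c → b ∉ Z)

/-- The sequence `q 0, …, q n` is a walk of the skeleton, all of whose inner nodes are active
given `Z`. -/
structure IsConn (Z : Set V) (n : ℕ) (q : ℕ → V) : Prop where
  adj : ∀ k, k < n → G.skeleton.Adj (q k) (q (k + 1))
  active : ∀ k, k + 2 ≤ n → G.Active Z (q k) (q (k + 1)) (q (k + 2))

variable {G} {Z : Set V}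

lemma isCollider_comm {a b c : V} : G.IsCollider a b c ↔ G.IsCollider c b a := And.comm

lemma Active.symm {a b c : V} (h : G.Active Z a b c) : G.Active Z c b a := by
  unfold Active at *
  rwa [isCollider_comm]

lemma HeadAt.adj {a b : V} (h : G.HeadAt a b) : G.skeleton.Adj a b := by
  rcases h with h | h
  · exact Or.inl h
  · exact Or.inr (Or.inr h)

lemma arrow_of_not_headAt {a b : V} (h : G.skeleton.Adj a b) (hn : ¬ G.HeadAt a b) :
    G.arrow b a := by
  rcases h with h | h | h
  · exact absurd (Or.inl h) hn
  · exact h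
  · exact absurd (Or.inr h) hn

lemma not_headAt_of_arrow {a b : V} (h : G.arrow b a) : ¬ G.HeadAt a b := by
  rintro (h' | h')
  · exact G.arrow_asymm _ _ h h'
  · exact G.arrow_not_arc _ _ h (G.arc_symm _ _ h')

lemma arc_of_headAt {a b : V} (h : G.HeadAt a b) (h' : G.HeadAt b a) : G.arc a b := by
  rcases h with h | h
  · exact absurd h' (not_headAt_of_arrow h)
  · exact h

lemma InAn.of_anc {u v : V} (h : G.Anc u v) (hv : G.InAn Z v) : G.InAn Z u := by
  rcases hv with hv | ⟨z, hz, hv⟩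
  · exact Or.inr ⟨v, hv, h⟩
  · exact Or.inr ⟨z, hz, h.trans hv⟩

lemma InAn.of_arrow {u v : V} (h : G.arrow u v) (hv : G.InAn Z v) : G.InAn Z u :=
  hv.of_anc (.single h)

lemma IsConn.prefix {n l : ℕ} {q : ℕ → V} (h : G.IsConn Z n q) (hl : l ≤ n) : G.IsConn Z l q :=
  ⟨fun k hk => h.adj k (by omega), fun k hk => h.active k (by omega)⟩

lemma IsConn.suffix {n m : ℕ} {q : ℕ → V} (h : G.IsConn Z n q) (hm : m ≤ n) :
    G.IsConn Z (n - m) (fun k => q (m + k)) :=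
  ⟨fun k hk => h.adj (m + k) (by omega), fun k hk => h.active (m + k) (by omega)⟩

lemma IsConn.reverse {n : ℕ} {q : ℕ → V} (h : G.IsConn Z n q) :
    G.IsConn Z n (fun k => q (n - k)) := by
  refine ⟨fun k hk => ?_, fun k hk => ?_⟩
  · have := (h.adj (n - (k + 1)) (by omega)).symm
    rwa [show n - (k + 1) + 1 = n - k by omega] at this
  · have := (h.active (n - (k + 2)) (by omega)).symm
    rwa [show n - (k + 2) + 1 = n - (k + 1) by omega,
      show n - (k + 2) + 2 = n - k by omega] at this

/-- Concatenation of `p 0, …, p a` and `r 0, r 1, …`. -/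
def glue (p : ℕ → V) (a : ℕ) (r : ℕ → V) (k : ℕ) : V := if k ≤ a then p k else r (k - (a + 1))

lemma glue_left {p : ℕ → V} {a : ℕ} {r : ℕ → V} {k : ℕ} (h : k ≤ a) : glue p a r k = p k :=
  if_pos h

lemma glue_right {p : ℕ → V} {a : ℕ} {r : ℕ → V} (k : ℕ) : glue p a r (a + 1 + k) = r k := by
  unfold glue
  rw [if_neg (by omega)]
  congr 1
  omega

/-- Only the triples centred at the two ends of the joining edge are new. The bounds on `a` and `b`
drop a condition when its centre is an endpoint of the whole sequence. -/
lemma IsConn.glue {p r : ℕ → V} {a b : ℕ} (hp : G.IsConn Z a p) (hr : G.IsConn Z b r)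
    (h : G.skeleton.Adj (p a) (r 0))
    (h₁ : 1 ≤ a → G.Active Z (p (a - 1)) (p a) (r 0))
    (h₂ : 1 ≤ b → G.Active Z (p a) (r 0) (r 1)) :
    G.IsConn Z (a + 1 + b) (glue p a r) := by
  refine ⟨fun k hk => ?_, fun k hk => ?_⟩
  · rcases lt_trichotomy k a with hka | rfl | hka
    · rw [glue_left hka.le, glue_left hka]
      exact hp.adj k hka
    · rw [glue_left le_rfl]
      exact (glue_right (p := p) (a := k) (r := r) 0) ▸ h
    · obtain ⟨j, rfl⟩ := Nat.exists_eq_add_of_lt hka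
      rw [show a + j + 1 = a + 1 + j by omega, add_assoc (a + 1), glue_right, glue_right]
      exact hr.adj j (by omega)
  · rcases lt_or_ge (k + 1) a with hka | hka
    · rw [glue_left (by omega), glue_left (by omega), glue_left (by omega)]
      exact hp.active k (by omega)
    · rcases eq_or_lt_of_le hka with hka | hka
      · subst hka
        rw [glue_left (by omega), glue_left le_rfl]
        exact (glue_right (p := p) (a := k + 1) (r := r) 0) ▸ h₁ (by omega)
      · rcases eq_or_lt_of_le (Nat.lt_succ_iff.mp hka) with hka | hka
        · subst hka
          rw [glue_left le_rfl]
          have e0 := glue_right (p := p) (a := a) (r := r) 0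
          have e1 := glue_right (p := p) (a := a) (r := r) 1
          rw [add_zero] at e0
          rw [show a + 2 = a + 1 + 1 by omega, e0, e1]
          exact h₂ (by omega)
        · obtain ⟨j, rfl⟩ := Nat.exists_eq_add_of_lt hka
          rw [show a + j + 1 = a + 1 + j by omega, add_assoc (a + 1), add_assoc (a + 1),
            glue_right, glue_right, glue_right]
          exact hr.active j (by omega)

/-! ### Ranks, weights and minimal connecting sequences -/

variable (G) in
/-- The number of descendants of a node, plus one. -/
noncomputable def rank (v : V) : ℕ := {w | G.Anc v w}.ncard + 1

variable (G) in
/-- The total rank of the nodes of a sequence. -/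
noncomputable def weight (n : ℕ) (q : ℕ → V) : ℕ := ∑ k ∈ Finset.range (n + 1), G.rank (q k)

lemma weight_glue (p r : ℕ → V) (a b : ℕ) :
    G.weight (a + 1 + b) (glue p a r) = G.weight a p + G.weight b r := by
  unfold weight
  rw [add_assoc (a + 1) b 1, Finset.sum_range_add]
  congr 1
  · exact Finset.sum_congr rfl fun k hk => by
      rw [glue_left (Nat.lt_succ_iff.mp (Finset.mem_range.mp hk))]
  · exact Finset.sum_congr rfl fun k _ => by rw [glue_right]

lemma weight_reverse (n : ℕ) (q : ℕ → V) : G.weight n (fun k => q (n - k)) = G.weight n q := by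
  unfold weight
  rw [← Finset.sum_range_reflect]
  exact Finset.sum_congr rfl fun k hk => by
    have := Finset.mem_range.mp hk
    simp only [show n - (n + 1 - 1 - k) = k by omega]

/-- Splitting off a proper middle part of a sequence. -/
lemma weight_split (q : ℕ → V) {n l m : ℕ} (hlm : l ≤ m) (hm : m < n) :
    G.weight l q + ∑ k ∈ Finset.Ico (l + 1) (m + 1), G.rank (q k)
      + G.weight (n - (m + 1)) (fun k => q (m + 1 + k)) = G.weight n q := by
  unfold weight
  rw [Finset.sum_range_add_sum_Ico _ (by omega)]
  conv_rhs => rw [show n + 1 = m + 1 + (n - (m + 1) + 1) by omega, Finset.sum_range_add]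

lemma rank_le_sum (q : ℕ → V) {l s m : ℕ} (hl : l < s) (hm : s ≤ m) :
    G.rank (q s) ≤ ∑ k ∈ Finset.Ico (l + 1) (m + 1), G.rank (q k) :=
  Finset.single_le_sum (f := fun k => G.rank (q k)) (fun _ _ => Nat.zero_le _)
    (Finset.mem_Ico.mpr ⟨by omega, by omega⟩)

lemma rank_pos (v : V) : 0 < G.rank v := Nat.succ_pos _

variable (G Z) in
/-- A connecting sequence of minimal weight among those with the same endpoints. -/
structure IsMinConn (n : ℕ) (q : ℕ → V) : Prop extends G.IsConn Z n q where
  min : ∀ n' q', G.IsConn Z n' q' → q' 0 = q 0 → q' n' = q n → G.weight n q ≤ G.weight n' q'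

lemma IsConn.exists_min {n : ℕ} {q : ℕ → V} (h : G.IsConn Z n q) :
    ∃ n' q', G.IsMinConn Z n' q' ∧ q' 0 = q 0 ∧ q' n' = q n := by
  classical
  have hex : ∃ w n' q', G.IsConn Z n' q' ∧ q' 0 = q 0 ∧ q' n' = q n ∧ G.weight n' q' = w :=
    ⟨_, n, q, h, rfl, rfl, rfl⟩
  obtain ⟨n', q', hc, h0, hn, hw⟩ := Nat.find_spec hex
  refine ⟨n', q', ⟨hc, fun n'' q'' hc' h0' hn' => ?_⟩, h0, hn⟩
  rw [hw]
  exact Nat.find_min' hex ⟨n'', q'', hc', h0'.trans h0, hn'.trans hn, rfl⟩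

lemma IsMinConn.reverse {n : ℕ} {q : ℕ → V} (h : G.IsMinConn Z n q) :
    G.IsMinConn Z n (fun k => q (n - k)) := by
  refine ⟨h.toIsConn.reverse, fun n' q' hc h0 hn => ?_⟩
  rw [weight_reverse, ← weight_reverse n' q']
  refine h.min _ _ hc.reverse ?_ ?_
  · simpa using hn
  · simpa using h0

/-- A minimal connecting sequence cannot be shortened. -/
lemma IsMinConn.not_active_of_adj {n l m : ℕ} {q : ℕ → V} (h : G.IsMinConn Z n q) (hlm : l < m)
    (hm : m < n) (hadj : G.skeleton.Adj (q l) (q (m + 1)))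
    (h₁ : 1 ≤ l → G.Active Z (q (l - 1)) (q l) (q (m + 1)))
    (h₂ : m + 2 ≤ n → G.Active Z (q l) (q (m + 1)) (q (m + 2))) : False := by
  have hc := (h.toIsConn.prefix (l := l) (by omega)).glue
    (h.toIsConn.suffix (m := m + 1) (by omega)) hadj h₁ (fun _ => h₂ (by omega))
  have hw := h.min _ _ hc (glue_left (Nat.zero_le _)) (by
    rw [glue_right]; congr 1; omega)
  rw [weight_glue, ← weight_split q hlm.le hm] at hw
  have := rank_le_sum (G := G) q hlm le_rfl
  have := rank_pos (G := G) (q m)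
  omega

end MixedGraph

/-! ### Minimal connecting sequences have no repeated nodes -/

namespace DirectedAncestralGraph

open MixedGraph

variable {V : Type*} {G : DirectedAncestralGraph V} {Z : Set V}

lemma not_anc_of_headAt {a b : V} (h : G.HeadAt a b) : ¬ G.Anc b a := by
  intro h'
  rcases h with h | h
  · exact G.acyclic _ (h'.trans (.single h))
  · exact G.ancestral _ _ (G.arc_symm _ _ h) h'

/-- Otherwise `c → a`, and `b → c → a` makes `b` an ancestor of `a` despite the arrowhead at `b`. -/
lemma headAt_trans {a b c : V} (h : G.HeadAt a b) (h' : G.arrow b c) (hac : G.skeleton.Adj a c) :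
    G.HeadAt a c := by
  by_contra hn
  exact not_anc_of_headAt h ((Relation.TransGen.single h').tail (arrow_of_not_headAt hac hn))

lemma rank_lt_of_anc [Finite V] {a b : V} (h : G.Anc a b) : G.rank b < G.rank a := by
  unfold rank
  refine Nat.succ_lt_succ (Set.ncard_lt_ncard ⟨fun w hw => ?_, fun hs => ?_⟩ (Set.toFinite _))
  · exact Relation.TransGen.trans h hw
  · exact G.acyclic b (hs h)

/-- A connecting sequence that starts with an arrow is directed up to `q m`, or reaches `Z`. -/
lemma directed_or_inAn {n l m : ℕ} {q : ℕ → V} (h : G.IsConn Z n q) (hl : G.arrow (q l) (q (l + 1)))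
    (hlm : l < m) (hm : m ≤ n) : G.Anc (q l) (q m) ∧ G.arrow (q (m - 1)) (q m) ∨ G.InAn Z (q l) := by
  induction m, hlm using Nat.le_induction with
  | base => exact Or.inl ⟨.single hl, hl⟩
  | succ m hlm ih =>
    rcases ih (by omega) with ⟨ha, hm'⟩ | hz
    · obtain ⟨j, rfl⟩ : ∃ j, m = j + 1 := ⟨m - 1, by omega⟩
      by_cases hc : G.IsCollider (q j) (q (j + 1)) (q (j + 2))
      · exact Or.inr (((h.active j (by omega)).1 hc).of_anc ha)
      · have hr := arrow_of_not_headAt (h.adj (j + 1) (by omega)).symm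
          fun hh => hc ⟨Or.inl hm', hh⟩
        exact Or.inl ⟨ha.tail hr, hr⟩
    · exact Or.inr hz

/-- This permits cutting out a loop. If the new triple is a non-collider, one of its edges has no
head at the repeated node, so that node was already a non-collider on one of its two visits. If it
is a collider and the first visit was not, the loop leaves by an arrow; since it cannot be a
directed cycle, it runs into an active collider. -/
lemma active_of_loop {n l m : ℕ} {q : ℕ → V} (h : G.IsConn Z n q) (hlm : l + 1 < m) (hm : m < n)
    (heq : q (l + 1) = q m) : G.Active Z (q l) (q m) (q (m + 1)) := by
  have h1 := h.active l (by omega)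
  obtain ⟨j, rfl⟩ : ∃ j, m = j + 1 := ⟨m - 1, by omega⟩
  have h2 := h.active j (by omega)
  rw [heq] at h1
  refine ⟨fun hc => ?_, fun hc => ?_⟩
  · by_cases hc1 : G.IsCollider (q l) (q (j + 1)) (q (l + 2))
    · exact h1.1 hc1
    · have hr := arrow_of_not_headAt (heq ▸ h.adj (l + 1) (by omega)).symm
        fun hh => hc1 ⟨hc.1, hh⟩
      rcases directed_or_inAn h (l := l + 1) (heq ▸ hr) hlm hm.le with hd | hz
      · exact absurd (heq ▸ hd.1) (G.acyclic _)
      · exact heq ▸ hz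
  · by_cases hh : G.HeadAt (q l) (q (j + 1))
    · exact h2.2 fun hc2 => hc ⟨hh, hc2.2⟩
    · exact h1.2 fun hc1 => hh hc1.1

lemma _root_.MixedGraph.IsMinConn.ne {n l m : ℕ} {q : ℕ → V} (h : G.IsMinConn Z n q) (hlm : l < m)
    (hm : m ≤ n) : q l ≠ q m := by
  intro heq
  rcases Nat.eq_zero_or_pos l with rfl | hl
  · have hw := h.min _ _ (h.toIsConn.suffix hm) heq.symm (by congr 1; omega)
    obtain ⟨j, rfl⟩ : ∃ j, m = j + 1 := ⟨m - 1, by omega⟩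
    rw [← weight_split q (Nat.zero_le j) (by omega)] at hw
    have : 0 < G.weight 0 q := by simp [weight, rank_pos]
    omega
  · obtain ⟨i, rfl⟩ : ∃ i, l = i + 1 := ⟨l - 1, by omega⟩
    rcases eq_or_lt_of_le hm with rfl | hm
    · have hw := h.min _ _ (h.toIsConn.prefix hlm.le) rfl heq
      obtain ⟨j, rfl⟩ : ∃ j, m = j + 1 := ⟨m - 1, by omega⟩
      rw [← weight_split q (show i + 1 ≤ j by omega) (by omega)] at hw
      have : 0 < G.weight (j + 1 - (j + 1)) fun k => q (j + 1 + k) :=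
        Finset.sum_pos (fun _ _ => rank_pos _) ⟨0, by simp⟩
      omega
    · obtain ⟨j, rfl⟩ : ∃ j, m = j + 1 := ⟨m - 1, by omega⟩
      refine h.not_active_of_adj (l := i) (m := j) (by omega) (by omega)
        (heq ▸ h.adj i (by omega)) (fun hi => ?_) fun hj => ?_
      · obtain ⟨i, rfl⟩ : ∃ i', i = i' + 1 := ⟨i - 1, by omega⟩
        exact heq ▸ h.active i (by omega)
      · exact active_of_loop h.toIsConn hlm (by omega) heq

end DirectedAncestralGraph

/-! ### Discriminating paths -/

namespace DirectedAncestralGraph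

open MixedGraph

variable {V : Type*} {G H : DirectedAncestralGraph V} {Z : Set V}

/-- Walking backwards from `q t`, either a prefix of `q` can be continued with `c`, or there is a
discriminating path towards `c`. -/
lemma exists_prefix_or_discriminating {n : ℕ} {q : ℕ → V} (h : G.IsConn Z n q) (c : V) (t : ℕ)
    (ht : t < n) (hc : G.HeadAt (q t) c)
    (harc : G.arrow (q t) (q (t + 1)) → G.arc (q t) c → G.InAn Z (q t)) :
    (∃ l ≤ t, G.HeadAt (q l) c ∧ (1 ≤ l → G.Active Z (q (l - 1)) (q l) c)) ∨
    ∃ m, 1 ≤ m ∧ m ≤ t ∧ (∀ k, m ≤ k → k ≤ t →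
      G.IsCollider (q (k - 1)) (q k) (q (k + 1)) ∧ G.arrow (q k) c) ∧
      ¬ G.skeleton.Adj (q (m - 1)) c := by
  induction t with
  | zero => exact Or.inl ⟨0, le_rfl, hc, fun h => absurd h (by omega)⟩
  | succ t ih =>
    by_cases ha : G.Active Z (q t) (q (t + 1)) c
    · exact Or.inl ⟨t + 1, le_rfl, hc, fun _ => ha⟩
    have hact := h.active t (by omega)
    -- A collider towards `c` outside the ancestors of Z would force both `q (t + 1) → q (t + 2)`
    -- and `q (t + 1) ↔ c`, which `harc` excludes. So the failure comes from a non-collider towards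
    -- `c` that lies in Z, hence is a collider on `q`.
    have key : q (t + 1) ∈ Z ∧ G.IsCollider (q t) (q (t + 1)) (q (t + 2)) ∧
        G.arrow (q (t + 1)) c := by
      by_cases hcol : G.IsCollider (q t) (q (t + 1)) c
      · have hz : ¬ G.InAn Z (q (t + 1)) := fun hz => ha ⟨fun _ => hz, fun hn => absurd hcol hn⟩
        have hnc : ¬ G.IsCollider (q t) (q (t + 1)) (q (t + 2)) := fun h' => hz (hact.1 h')
        have hr := arrow_of_not_headAt (h.adj (t + 1) ht).symm fun hh => hnc ⟨hcol.1, hh⟩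
        exact absurd (harc hr (arc_of_headAt hc hcol.2)) hz
      · have hz : q (t + 1) ∈ Z := by
          by_contra hz
          exact ha ⟨fun hn => absurd hn hcol, fun _ => hz⟩
        have hcq : G.IsCollider (q t) (q (t + 1)) (q (t + 2)) := by
          by_contra hn
          exact hact.2 hn hz
        exact ⟨hz, hcq, arrow_of_not_headAt hc.adj.symm fun hh => hcol ⟨hcq.1, hh⟩⟩
    obtain ⟨hz, hcq, hr⟩ := key
    by_cases hadj : G.skeleton.Adj (q t) c
    · rcases ih (by omega) (headAt_trans hcq.1 hr hadj)
        (fun hr' _ => InAn.of_arrow hr' (Or.inl hz)) with ⟨l, hl, hl'⟩ | ⟨m, h1, hm, hk, hn⟩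
      · exact Or.inl ⟨l, by omega, hl'⟩
      · refine Or.inr ⟨m, h1, by omega, fun k hmk hkt => ?_, hn⟩
        rcases eq_or_lt_of_le hkt with rfl | hkt
        · exact ⟨hcq, hr⟩
        · exact hk k hmk (by omega)
    · refine Or.inr ⟨t + 1, by omega, le_rfl, fun k hmk hkt => ?_, hadj⟩
      obtain rfl : k = t + 1 := by omega
      exact ⟨hcq, hr⟩

variable (G) in
/-- The sequence `q` contains a discriminating path for `q s`, with final node `q (s + 1)` and
colliders `q m, …, q (s - 1)`. -/
structure Discriminates (q : ℕ → V) (s m : ℕ) : Prop where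
  one_le : 1 ≤ m
  lt : m < s
  collider : ∀ k, m ≤ k → k < s → G.IsCollider (q (k - 1)) (q k) (q (k + 1))
  arrow : ∀ k, m ≤ k → k < s → G.arrow (q k) (q (s + 1))
  not_adj : ¬ G.skeleton.Adj (q (m - 1)) (q (s + 1))

/-- The failure makes `q s` a collider in Z with `q s → q (s + 2)`. Walking back from it yields a
discriminating path or a prefix that jumps to `q (s + 2)` with a head there. The edge from `q (s +
1)` has a head there too, so such a jump would keep the next triple active and contradict
minimality. -/
lemma exists_discriminates_of_not_active {n s : ℕ} {q : ℕ → V} (h : G.IsMinConn Z n q)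
    (hs : 1 ≤ s) (hsn : s + 2 ≤ n) (hadj : G.skeleton.Adj (q s) (q (s + 2)))
    (hna : ¬ G.Active Z (q (s - 1)) (q s) (q (s + 2))) : ∃ m, G.Discriminates q (s + 1) m := by
  obtain ⟨t, rfl⟩ : ∃ t, s = t + 1 := ⟨s - 1, by omega⟩
  rw [Nat.add_sub_cancel] at hna
  have hAB := h.adj (t + 1) (by omega)
  have hBC := h.adj (t + 2) (by omega)
  have hact := h.active t (by omega)
  have harc : G.arrow (q (t + 1)) (q (t + 2)) → G.HeadAt (q (t + 3)) (q (t + 1)) →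
      G.InAn Z (q (t + 1)) := fun hr hh =>
    InAn.of_arrow hr ((h.active (t + 1) (by omega)).1 ⟨Or.inl hr, headAt_trans hh hr hBC.symm⟩)
  have hcol : ¬ G.IsCollider (q t) (q (t + 1)) (q (t + 3)) := by
    intro hcol
    have hz : ¬ G.InAn Z (q (t + 1)) := fun hz => hna ⟨fun _ => hz, fun hn => absurd hcol hn⟩
    have hnc : ¬ G.IsCollider (q t) (q (t + 1)) (q (t + 2)) := fun h' => hz (hact.1 h')
    exact hz (harc (arrow_of_not_headAt hAB.symm fun hh => hnc ⟨hcol.1, hh⟩) hcol.2)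
  have hz : q (t + 1) ∈ Z := by
    by_contra hz
    exact hna ⟨fun hn => absurd hn hcol, fun _ => hz⟩
  have hcq : G.IsCollider (q t) (q (t + 1)) (q (t + 2)) := by
    by_contra hn
    exact hact.2 hn hz
  have hAC : G.arrow (q (t + 1)) (q (t + 3)) :=
    arrow_of_not_headAt hadj.symm fun hh => hcol ⟨hcq.1, hh⟩
  have hB : G.HeadAt (q (t + 2)) (q (t + 3)) := headAt_trans hcq.2 hAC hBC
  rcases exists_prefix_or_discriminating h.toIsConn (q (t + 3)) (t + 1) (by omega) (Or.inl hAC)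
    (fun _ _ => Or.inl hz) with ⟨l, hl, hhead, hl'⟩ | ⟨m, h1, hm, hk, hn⟩
  · refine (h.not_active_of_adj (l := l) (m := t + 2) (by omega) (by omega) hhead.adj hl'
      fun hj => ?_).elim
    have := h.active (t + 2) (by omega)
    exact ⟨fun hc => this.1 ⟨hB, hc.2⟩, fun hc => this.2 fun hc' => hc ⟨hhead, hc'.2⟩⟩
  · exact ⟨m, h1, by omega, fun k hmk hk' => (hk k hmk (by omega)).1,
      fun k hmk hk' => (hk k hmk (by omega)).2, hn⟩

/-- A shielded triple of a minimal connecting sequence is discriminated by that sequence or by its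
reverse. -/
lemma exists_discriminates {n s : ℕ} {q : ℕ → V} (h : G.IsMinConn Z n q)
    (hs : 1 ≤ s) (hsn : s < n) (hadj : G.skeleton.Adj (q (s - 1)) (q (s + 1))) :
    (∃ m, G.Discriminates q s m) ∨ ∃ m, G.Discriminates (fun k => q (n - k)) (n - s) m := by
  obtain ⟨t, rfl⟩ : ∃ t, s = t + 1 := ⟨s - 1, by omega⟩
  rw [Nat.add_sub_cancel] at hadj
  -- Bypassing `q s` must fail at one of the neighbours; failure at the right one is handled on the
  -- reversed sequence.
  by_cases h1 : 1 ≤ t → G.Active Z (q (t - 1)) (q t) (q (t + 2))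
  · right
    by_contra hn
    refine h.not_active_of_adj (l := t) (m := t + 1) (by omega) (by omega) hadj h1 fun h3 => ?_
    by_contra hna
    obtain ⟨u, hu⟩ : ∃ u, n = t + 2 + (u + 1) := ⟨n - (t + 3), by omega⟩
    refine hn ?_
    rw [show n - (t + 1) = u + 1 + 1 by omega]
    refine exists_discriminates_of_not_active h.reverse (by omega) (by omega) ?_ fun ha => hna ?_
    · rw [show n - (u + 1) = t + 2 by omega, show n - (u + 1 + 2) = t by omega]
      exact hadj.symm
    · rw [show n - (u + 1) = t + 2 by omega, show n - (u + 1 + 2) = t by omega,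
        show n - (u + 1 - 1) = t + 3 by omega] at ha
      exact ha.symm
  · push Not at h1
    exact Or.inl (exists_discriminates_of_not_active h h1.1 (by omega) hadj h1.2)

/-- `G` and `H` agree on the collider status of the last inner node of every path that is
discriminating (possibly with no further inner node, that is, unshielded) in both graphs. -/
def SameDiscriminated (G H : DirectedAncestralGraph V) : Prop :=
  ∀ (q : ℕ → V) (n : ℕ) (j : V), 1 ≤ n → (∀ k l, k < l → l ≤ n → q k ≠ q l) → (∀ k ≤ n, q k ≠ j) →
    (∀ k < n, G.skeleton.Adj (q k) (q (k + 1))) → (∀ k, 1 ≤ k → k ≤ n → G.skeleton.Adj (q k) j) →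
    ¬ G.skeleton.Adj (q 0) j →
    (∀ k, 1 ≤ k → k < n → G.IsCollider (q (k - 1)) (q k) (q (k + 1)) ∧
      H.IsCollider (q (k - 1)) (q k) (q (k + 1)) ∧ G.arrow (q k) j ∧ H.arrow (q k) j) →
    (G.IsCollider (q (n - 1)) (q n) j ↔ H.IsCollider (q (n - 1)) (q n) j)

lemma SameDiscriminated.symm (hs : G.skeleton = H.skeleton) (h : SameDiscriminated G H) :
    SameDiscriminated H G := by
  intro q n j h1 hinj hj hadj hadjj hna hk
  exact (h q n j h1 hinj hj (by rwa [hs]) (by rwa [hs]) (by rwa [hs]) fun k hk1 hkn =>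
    ⟨(hk k hk1 hkn).2.1, (hk k hk1 hkn).1, (hk k hk1 hkn).2.2.2, (hk k hk1 hkn).2.2.1⟩).symm

/-- For agreement on a discriminating path of `G` it is enough that its inner nodes are colliders
in `H`. -/
lemma SameDiscriminated.isCollider_iff (hs : G.skeleton = H.skeleton) (h : SameDiscriminated G H)
    {q : ℕ → V} {n : ℕ} {j : V} (hn : 1 ≤ n) (hinj : ∀ k l, k < l → l ≤ n → q k ≠ q l)
    (hj : ∀ k ≤ n, q k ≠ j) (hadj : ∀ k < n, G.skeleton.Adj (q k) (q (k + 1)))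
    (hadjn : G.skeleton.Adj (q n) j) (hna : ¬ G.skeleton.Adj (q 0) j)
    (hG : ∀ k, 1 ≤ k → k < n → G.IsCollider (q (k - 1)) (q k) (q (k + 1)))
    (hH : ∀ k, 1 ≤ k → k < n → H.IsCollider (q (k - 1)) (q k) (q (k + 1)))
    (hr : ∀ k, 1 ≤ k → k < n → G.arrow (q k) j) :
    G.IsCollider (q (n - 1)) (q n) j ↔ H.IsCollider (q (n - 1)) (q n) j := by
  have hadjj : ∀ k, 1 ≤ k → k ≤ n → G.skeleton.Adj (q k) j := fun k h1 h2 => by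
    rcases eq_or_lt_of_le h2 with rfl | h2
    · exact hadjn
    · exact Or.inl (hr k h1 h2)
  -- Arrows into `j` transfer one by one: the path truncated at `q k` is discriminating in both
  -- graphs, so `q k` is a non-collider towards `j` in H as well, and the head from `q (k - 1)`
  -- forces `q k → j`.
  have hrH : ∀ k, 1 ≤ k → k < n → H.arrow (q k) j := by
    intro k
    induction k using Nat.strong_induction_on with
    | _ k ih =>
      intro h1 hkn
      have hiff := h q k j h1 (fun a b hab hb => hinj a b hab (by omega))
        (fun a ha => hj a (by omega)) (fun a ha => hadj a (by omega))
        (fun a h1 h2 => hadjj a h1 (by omega)) hna fun a h1 h2 =>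
          ⟨hG a h1 (by omega), hH a h1 (by omega), hr a h1 (by omega), ih a h2 h1 (by omega)⟩
      have hnc : ¬ H.IsCollider (q (k - 1)) (q k) j := fun hc =>
        not_headAt_of_arrow (hr k h1 hkn) (hiff.2 hc).2
      exact arrow_of_not_headAt (hs ▸ (hadjj k h1 hkn.le).symm)
        fun hh => hnc ⟨(hH k h1 hkn).1, hh⟩
  exact h q n j hn hinj hj hadj hadjj hna fun k h1 h2 =>
    ⟨hG k h1 h2, hH k h1 h2, hr k h1 h2, hrH k h1 h2⟩

/-- The version for a segment `q (m - 1), …, q s` of a sequence. -/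
lemma SameDiscriminated.segment (hs : G.skeleton = H.skeleton) (h : SameDiscriminated G H)
    {q : ℕ → V} {m s : ℕ} {j : V} (hm : 1 ≤ m) (hms : m ≤ s)
    (hinj : ∀ k l, k < l → l ≤ s → q k ≠ q l)
    (hj : ∀ k, m - 1 ≤ k → k ≤ s → q k ≠ j) (hadj : ∀ k < s, G.skeleton.Adj (q k) (q (k + 1)))
    (hadjs : G.skeleton.Adj (q s) j) (hna : ¬ G.skeleton.Adj (q (m - 1)) j)
    (hG : ∀ k, m ≤ k → k < s → G.IsCollider (q (k - 1)) (q k) (q (k + 1)))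
    (hH : ∀ k, m ≤ k → k < s → H.IsCollider (q (k - 1)) (q k) (q (k + 1)))
    (hr : ∀ k, m ≤ k → k < s → G.arrow (q k) j) :
    G.IsCollider (q (s - 1)) (q s) j ↔ H.IsCollider (q (s - 1)) (q s) j := by
  obtain ⟨m, rfl⟩ : ∃ m', m = m' + 1 := ⟨m - 1, by omega⟩
  obtain ⟨u, rfl⟩ : ∃ u, s = m + (u + 1) := ⟨s - (m + 1), by omega⟩
  rw [Nat.add_sub_cancel] at hj hna
  have e : ∀ k, 1 ≤ k → m + k - 1 = m + (k - 1) := fun k hk => by omega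
  refine h.isCollider_iff hs (q := fun k => q (m + k)) (n := u + 1) (by omega)
    (fun k l hkl hl => hinj _ _ (by omega) (by omega)) (fun k hk => hj _ (by omega) (by omega))
    (fun k hk => hadj (m + k) (by omega)) hadjs hna (fun k h1 h2 => ?_) (fun k h1 h2 => ?_)
    fun k h1 h2 => hr _ (by omega) (by omega)
  · exact e k h1 ▸ hG (m + k) (by omega) (by omega)
  · exact e k h1 ▸ hH (m + k) (by omega) (by omega)

end DirectedAncestralGraph

/-! ### Passing between paths and sequences -/

lemma List.triple_infix_of_getElem {α : Type*} (l : List α) (k : ℕ) (h : k + 2 < l.length) :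
    [l[k], l[k + 1], l[k + 2]] <:+: l := by
  refine ⟨l.take k, l.drop (k + 3), ?_⟩
  conv_rhs => rw [← List.take_append_drop k l, List.drop_eq_getElem_cons (by omega),
    List.drop_eq_getElem_cons (by omega), List.drop_eq_getElem_cons (by omega)]
  simp

lemma List.exists_of_triple_infix_map_range {α : Type*} {q : ℕ → α} {n : ℕ} {x y z : α}
    (h : [x, y, z] <:+: (List.range n).map q) :
    ∃ k, k + 3 ≤ n ∧ x = q k ∧ y = q (k + 1) ∧ z = q (k + 2) := by
  obtain ⟨s, t, h⟩ := h
  have hlen := congrArg List.length h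
  simp at hlen
  have e : ∀ i, (s ++ [x, y, z] ++ t)[s.length + i]? = ((List.range n).map q)[s.length + i]? :=
    fun i => by rw [h]
  have e0 := e 0
  have e1 := e 1
  have e2 := e 2
  rw [List.getElem?_map, List.getElem?_range (by omega)] at e0 e1 e2
  simp at e0 e1 e2
  exact ⟨s.length, by omega, e0, e1, e2⟩

lemma SimpleGraph.exists_walk_of_adj {V : Type*} {S : SimpleGraph V} {q : ℕ → V} {n : ℕ}
    (h : ∀ k < n, S.Adj (q k) (q (k + 1))) :
    ∃ p : S.Walk (q 0) (q n), p.support = (List.range (n + 1)).map q := by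
  induction n with
  | zero => exact ⟨.nil, by simp⟩
  | succ n ih =>
    obtain ⟨p, hp⟩ := ih fun k hk => h k (by omega)
    refine ⟨p.concat (h n (by omega)), ?_⟩
    rw [SimpleGraph.Walk.support_concat, hp, List.range_succ (n := n + 1)]
    simp

namespace MixedGraph

variable {V : Type*} {G : MixedGraph V} {Z : Set V}

lemma Connecting.exists_isConn {a b : V} {p : G.skeleton.Walk a b} (h : G.Connecting Z p) :
    ∃ n q, G.IsConn Z n q ∧ q 0 = a ∧ q n = b := by
  refine ⟨p.length, p.getVert, ⟨fun k hk => p.adj_getVert_succ hk, fun k hk => ?_⟩,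
    p.getVert_zero, p.getVert_length⟩
  have hl := p.length_support
  have := h.2 _ _ _ (List.triple_infix_of_getElem p.support k (by omega))
  rw [← p.getVert_eq_support_getElem (by omega), ← p.getVert_eq_support_getElem (by omega),
    ← p.getVert_eq_support_getElem (by omega)] at this
  exact this

end MixedGraph

namespace DirectedAncestralGraph

open MixedGraph

variable {V : Type*} {G H : DirectedAncestralGraph V} {Z : Set V}

lemma exists_connecting {n : ℕ} {q : ℕ → V} (h : G.IsConn Z n q) :
    ∃ p : G.skeleton.Walk (q 0) (q n), G.Connecting Z p := by
  obtain ⟨n', q', hm, h0, hn⟩ := h.exists_min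
  obtain ⟨p, hp⟩ := SimpleGraph.exists_walk_of_adj hm.adj
  rw [← h0, ← hn]
  refine ⟨p, ?_, fun x y z hxyz => ?_⟩
  · rw [SimpleGraph.Walk.isPath_def, hp]
    refine List.Nodup.map_on (fun x hx y hy hxy => ?_) List.nodup_range
    rw [List.mem_range] at hx hy
    rcases lt_trichotomy x y with hlt | heq | hlt
    · exact absurd hxy (hm.ne hlt (by omega))
    · exact heq
    · exact absurd hxy.symm (hm.ne hlt (by omega))
  · rw [hp] at hxyz
    obtain ⟨k, hk, rfl, rfl, rfl⟩ := List.exists_of_triple_infix_map_range hxyz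
    exact hm.active k (by omega)

lemma separated_iff {A B C : Set V} :
    G.Separated A B C ↔ ∀ a ∈ A, ∀ b ∈ B, ¬ ∃ n q, G.IsConn C n q ∧ q 0 = a ∧ q n = b := by
  refine forall₂_congr fun a _ => forall₂_congr fun b _ => ⟨?_, ?_⟩
  · rintro h ⟨n, q, hc, rfl, rfl⟩
    obtain ⟨p, hp⟩ := exists_connecting hc
    exact h p hp
  · intro h p hp
    exact h hp.exists_isConn

/-- Every descendant of `v` is also outside Z and its ancestors, so the directed path can be
appended with all its nodes as unblocked non-colliders. -/
lemma _root_.MixedGraph.IsConn.exists_extend {G : MixedGraph V} {x v y : V} (hv : ¬ G.InAn Z v)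
    (h : G.Anc v y) (hq : ∃ n q, G.IsConn Z n q ∧ q 0 = x ∧ q n = v) :
    ∃ n q, G.IsConn Z n q ∧ q 0 = x ∧ q n = y := by
  have step : ∀ {v u : V}, ¬ G.InAn Z v → G.arrow v u →
      (∃ n q, G.IsConn Z n q ∧ q 0 = x ∧ q n = v) →
      ∃ n q, G.IsConn Z n q ∧ q 0 = x ∧ q n = u := by
    rintro v u hv hr ⟨n, q, hc, rfl, rfl⟩
    refine ⟨n + 1 + 0, glue q n fun _ => u, hc.glue ⟨fun k hk => absurd hk (by omega),
      fun k hk => absurd hk (by omega)⟩ (Or.inl hr) (fun _ => ⟨fun hc => ?_, fun _ hz =>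
        hv (Or.inl hz)⟩) (fun hk => absurd hk (by omega)), glue_left (Nat.zero_le _),
        glue_right 0⟩
    exact absurd hc.2 (not_headAt_of_arrow hr)
  induction h using Relation.TransGen.head_induction_on with
  | single hr => exact step hv hr hq
  | head hr _ ih => exact ih (fun hu => hv (hu.of_arrow hr)) (step hv hr hq)

/-! ### Inducing paths and agreement of colliders -/

/-- In a maximal graph the endpoints of a primitive inducing path are adjacent. -/
lemma adj_of_inducing (hmax : G.IsMaximal) {q : ℕ → V} {n : ℕ} (hne : q 0 ≠ q n)
    (hadj : ∀ k < n, G.skeleton.Adj (q k) (q (k + 1)))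
    (hcol : ∀ k, 1 ≤ k → k < n → G.IsCollider (q (k - 1)) (q k) (q (k + 1)))
    (hanc : ∀ k, 1 ≤ k → k < n → G.Anc (q k) (q 0) ∨ G.Anc (q k) (q n)) :
    G.skeleton.Adj (q 0) (q n) := by
  classical
  by_contra hna
  obtain ⟨C, _, hsep⟩ := hmax _ _ hne hna
  rw [separated_iff] at hsep
  refine hsep _ rfl _ rfl ?_
  have hn : 0 < n := Nat.pos_of_ne_zero fun h => hne (by rw [h])
  -- Let `l` be the last index satisfying `L`, and `m` the next index whose node is not in or above
  -- `C`; 0 and `n` are the defaults. The stretch between has active colliders only. Directed paths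
  -- outside `C` lead from `q l` back to `q 0` and, as `l` is last, from `q m` on to `q n`.
  let L : ℕ → Prop := fun k => k = 0 ∨ ¬ G.InAn C (q k) ∧ G.Anc (q k) (q 0)
  let l := Nat.findGreatest L (n - 1)
  have hl : L l := Nat.findGreatest_spec (Nat.zero_le _) (Or.inl rfl)
  have hln : l ≤ n - 1 := Nat.findGreatest_le _
  have hlmax : ∀ k, l < k → k ≤ n - 1 → ¬ L k := fun k h1 h2 => Nat.findGreatest_is_greatest h1 h2
  have hex : ∃ m, l < m ∧ (m = n ∨ ¬ G.InAn C (q m)) := ⟨n, by omega, Or.inl rfl⟩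
  obtain ⟨hlm, hm⟩ := Nat.find_spec hex
  have hmn : Nat.find hex ≤ n := Nat.find_min' hex ⟨by omega, Or.inl rfl⟩
  have hmin : ∀ k, l < k → k < Nat.find hex → G.InAn C (q k) := fun k h1 h2 => by
    by_contra h
    exact Nat.find_min hex h2 ⟨h1, Or.inr h⟩
  generalize Nat.find hex = m at hlm hm hmn hmin
  have hmid : ∃ n' q', G.IsConn C n' q' ∧ q' 0 = q l ∧ q' n' = q m := by
    refine ⟨m - l, fun k => q (l + k), ⟨fun k hk => hadj _ (by omega), fun k hk => ?_⟩, rfl,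
      congrArg q (Nat.add_sub_cancel' hlm.le)⟩
    have := hcol (l + k + 1) (by omega) (by omega)
    exact ⟨fun _ => hmin _ (by omega) (by omega), fun h => absurd this h⟩
  have hright : ∃ n' q', G.IsConn C n' q' ∧ q' 0 = q l ∧ q' n' = q n := by
    rcases eq_or_lt_of_le hmn with rfl | hmn
    · exact hmid
    · have hm := hm.resolve_left hmn.ne
      refine hmid.elim fun n' hq => IsConn.exists_extend hm ?_ ⟨n', hq⟩
      exact (hanc m (by omega) hmn).resolve_left fun h => hlmax m hlm (by omega) (Or.inr ⟨hm, h⟩)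
  rcases hl with hl | hl
  · rw [hl] at hright
    exact hright
  · obtain ⟨n', q', h, h0, hn⟩ := hright
    obtain ⟨n'', q'', h', h0', hn'⟩ := IsConn.exists_extend hl.1 hl.2
      ⟨n', _, h.reverse, rfl, by simpa using h0⟩
    refine ⟨n'', _, h'.reverse, by simpa using hn', ?_⟩
    simp only [Nat.sub_self, h0']
    simpa using hn

/-- A leftward and a rightward discriminated node are not both inner nodes of each other's
discriminating paths. -/
lemma Discriminates.not_crossing (hmax : G.IsMaximal) {n b d m p : ℕ} {q : ℕ → V}
    (h : G.IsMinConn Z n q) (hb : G.Discriminates q b m)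
    (hd : G.Discriminates (fun k => q (n - k)) (n - d) p) (hmd : m ≤ d) (hdb : d < b) (hbn : b < n)
    (hpb : p ≤ n - b) : False := by
  have hp := hd.one_le
  have hpd := hd.lt
  have hm := hb.one_le
  have hcolb := hd.collider (n - b) hpb (by omega)
  have harb := hd.arrow (n - b) hpb (by omega)
  rw [show n - (n - b - 1) = b + 1 by omega, show n - (n - b) = b by omega,
    show n - (n - b + 1) = b - 1 by omega] at hcolb
  rw [show n - (n - b) = b by omega, show n - (n - d + 1) = d - 1 by omega] at harb
  -- Here `q b → q (d - 1)`. If `m = d`, this makes `q (m - 1), …, q (b + 1)` an inducing path. If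
  -- `m < d`, then `q b → q (d - 1) → q (b + 1)` contradicts the head at `q b`.
  rcases eq_or_lt_of_le hmd with rfl | hmd
  · refine hb.not_adj ?_
    have := adj_of_inducing hmax (q := fun k => q (m - 1 + k)) (n := b + 1 - (m - 1))
      (h.ne (by omega) (by omega)) (fun k hk => h.adj _ (by omega)) (fun k h1 hk => ?_)
      (fun k h1 hk => ?_)
    · simpa only [add_zero, show m - 1 + (b + 1 - (m - 1)) = b + 1 by omega] using this
    · rw [show m - 1 + (k - 1) = m - 1 + k - 1 by omega]
      rcases eq_or_lt_of_le (show m - 1 + k ≤ b by omega) with e | hlt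
      · rw [← add_assoc, e]
        exact hcolb.symm
      · exact hb.collider _ (by omega) hlt
    · rw [show m - 1 + (b + 1 - (m - 1)) = b + 1 by omega]
      rcases eq_or_lt_of_le (show m - 1 + k ≤ b by omega) with e | hlt
      · rw [e]
        exact Or.inl (.single harb)
      · exact Or.inr (.single (hb.arrow _ (by omega) hlt))
  · exact not_anc_of_headAt hcolb.1 ((Relation.TransGen.single harb).tail
      (hb.arrow (d - 1) (by omega) (by omega)))

/-- If H had the same colliders before `q s`, the discriminating path would fall under
`SameDiscriminated`. -/
lemma exists_differing_of_discriminates (hs : G.skeleton = H.skeleton)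
    (hGH : SameDiscriminated G H) {n s m : ℕ} {q : ℕ → V} (h : G.IsMinConn Z n q) (hsn : s < n)
    (hd : G.Discriminates q s m)
    (hne : ¬ (G.IsCollider (q (s - 1)) (q s) (q (s + 1)) ↔
      H.IsCollider (q (s - 1)) (q s) (q (s + 1)))) :
    ∃ k, m ≤ k ∧ k < s ∧ ¬ (G.IsCollider (q (k - 1)) (q k) (q (k + 1)) ↔
      H.IsCollider (q (k - 1)) (q k) (q (k + 1))) := by
  by_contra! hcon
  have := hd.one_le
  have := hd.lt
  exact hne (hGH.segment hs hd.one_le hd.lt.le (fun k l hkl hl => h.ne hkl (by omega))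
    (fun k _ hk => h.ne (by omega) (by omega)) (fun k hk => h.adj k (by omega)) (h.adj s hsn)
    hd.not_adj hd.collider (fun k h1 h2 => (hcon k h1 h2).1 (hd.collider k h1 h2)) hd.arrow)

/-- Along a minimal connecting sequence of `G`, the graph `H` has the same colliders. -/
lemma isCollider_iff_of_isMinConn (hmax : G.IsMaximal) (hs : G.skeleton = H.skeleton)
    (hGH : SameDiscriminated G H) {n : ℕ} {q : ℕ → V} (h : G.IsMinConn Z n q) (s : ℕ) (h1 : 1 ≤ s)
    (hsn : s < n) :
    G.IsCollider (q (s - 1)) (q s) (q (s + 1)) ↔ H.IsCollider (q (s - 1)) (q s) (q (s + 1)) := by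
  classical
  let Bad : ℕ → Prop := fun s => 1 ≤ s ∧ s < n ∧
    ¬ (G.IsCollider (q (s - 1)) (q s) (q (s + 1)) ↔ H.IsCollider (q (s - 1)) (q s) (q (s + 1)))
  have hleft : ∀ s m, Bad s → G.Discriminates q s m → ∃ k, m ≤ k ∧ k < s ∧ Bad k := by
    rintro s m ⟨h1, h2, h3⟩ hd
    obtain ⟨k, hk1, hk2, hk3⟩ := exists_differing_of_discriminates hs hGH h h2 hd h3
    have := hd.one_le
    exact ⟨k, hk1, hk2, by omega, by omega, hk3⟩
  have hright : ∀ s p, Bad s → G.Discriminates (fun k => q (n - k)) (n - s) p →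
      ∃ k, s < k ∧ k ≤ n - p ∧ Bad k := by
    rintro s p ⟨h1, h2, h3⟩ hd
    have hp := hd.one_le
    obtain ⟨k, hk1, hk2, hk3⟩ := exists_differing_of_discriminates hs hGH h.reverse
      (by omega) hd (by
        rw [show n - (n - s - 1) = s + 1 by omega, show n - (n - s) = s by omega,
          show n - (n - s + 1) = s - 1 by omega]
        rwa [isCollider_comm, isCollider_comm (G := H.toMixedGraph)])
    refine ⟨n - k, by omega, by omega, by omega, by omega, ?_⟩
    rw [show n - (k - 1) = n - k + 1 by omega, show n - (k + 1) = n - k - 1 by omega] at hk3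
    rwa [isCollider_comm, isCollider_comm (G := H.toMixedGraph)]
  have hdisc : ∀ s, Bad s → (∃ m, G.Discriminates q s m) ∨
      ∃ p, G.Discriminates (fun k => q (n - k)) (n - s) p := by
    rintro s ⟨h1, h2, h3⟩
    refine exists_discriminates h h1 h2 (by_contra fun hna => h3 ?_)
    exact hGH.segment hs h1 le_rfl (fun k l hkl hl => h.ne hkl (by omega))
      (fun k _ hk => h.ne (by omega) (by omega)) (fun k hk => h.adj k (by omega)) (h.adj s h2) hna
      (fun k _ _ => by omega) (fun k _ _ => by omega) (fun k _ _ => by omega)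
  by_contra hbad
  have hex : ∃ s, Bad s := ⟨s, h1, hsn, hbad⟩
  -- Otherwise the last bad node is discriminated from the right, which produces a later bad node.
  have hexl : ∃ b, Bad b ∧ ∃ m, G.Discriminates q b m := by
    by_contra! hnl
    obtain ⟨t, ht, htmax⟩ : ∃ t, Bad t ∧ ∀ k, t < k → ¬ Bad k := by
      refine ⟨Nat.findGreatest Bad n, Nat.findGreatest_spec hsn.le ⟨h1, hsn, hbad⟩,
        fun k hk hb => Nat.findGreatest_is_greatest hk hb.2.1.le hb⟩
    obtain ⟨p, hp⟩ := (hdisc t ht).resolve_left fun ⟨m, hm⟩ => hnl t ht m hm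
    obtain ⟨k, hk, -, hkb⟩ := hright t p ht hp
    exact htmax k hk hkb
  obtain ⟨hb, m, hm⟩ := Nat.find_spec hexl
  have hbmin : ∀ d, d < Nat.find hexl → Bad d → ¬ ∃ m, G.Discriminates q d m :=
    fun d hd hbd hm => Nat.find_min hexl hd ⟨hbd, hm⟩
  generalize Nat.find hexl = b at hb hm hbmin
  obtain ⟨k, hmk, hkb, hk⟩ := hleft b m hb hm
  -- With `b` the first bad node discriminated from the left, `d` is the last bad node before it and
  -- is discriminated only from the right. The next disagreement to the right of `d` is at `b` or
  -- beyond, so the two discriminating paths cross.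
  let d := Nat.findGreatest Bad (b - 1)
  have hkd : k ≤ d := Nat.le_findGreatest (by omega) hk
  have hd : Bad d := Nat.findGreatest_spec (P := Bad) (show k ≤ b - 1 by omega) hk
  have hdb : d ≤ b - 1 := Nat.findGreatest_le _
  have hdmax : ∀ e, d < e → e ≤ b - 1 → ¬ Bad e :=
    fun e h1 h2 => Nat.findGreatest_is_greatest h1 h2
  obtain ⟨p, hp⟩ := (hdisc d hd).resolve_left (hbmin d (by omega) hd)
  obtain ⟨e, hde, hep, he⟩ := hright d p hd hp
  have hbe : b ≤ e := by
    by_contra hlt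
    exact hdmax e hde (by omega) he
  have := he.1
  exact Discriminates.not_crossing hmax h hm hp (by omega) (by omega) hb.2.1 (by omega)

end DirectedAncestralGraph

/-! ### Transfer of active colliders and Markov equivalence -/

namespace DirectedAncestralGraph

open MixedGraph

variable {V : Type*} {G H : DirectedAncestralGraph V} {Z : Set V}

lemma SameDiscriminated.unshielded (hGH : SameDiscriminated G H) {a b c : V} (hac : a ≠ c)
    (hab : G.skeleton.Adj a b) (hbc : G.skeleton.Adj b c) (hna : ¬ G.skeleton.Adj a c) :
    G.IsCollider a b c ↔ H.IsCollider a b c := by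
  have := hGH (fun k => if k = 0 then a else b) 1 c le_rfl (fun k l hkl hl => ?_) (fun k hk => ?_)
    (fun k hk => ?_) (fun k h1 hk => ?_) (by simpa using hna) (fun k h1 hk => by omega)
  · simpa using this
  · obtain ⟨rfl, rfl⟩ : k = 0 ∧ l = 1 := by omega
    simpa using hab.ne
  · split_ifs
    · exact hac
    · exact hbc.ne
  · obtain rfl : k = 0 := by omega
    simpa using hab
  · simpa [show k ≠ 0 by omega] using hbc

variable (G) in
/-- There is a directed path with `m` arrows from `v` to a node of `Z`. -/
def Descends (Z : Set V) : ℕ → V → Prop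
  | 0, v => v ∈ Z
  | m + 1, v => ∃ u, G.arrow v u ∧ Descends Z m u

lemma Descends.inAn {m : ℕ} {v : V} (h : G.Descends Z m v) : G.InAn Z v := by
  induction m generalizing v with
  | zero => exact Or.inl h
  | succ m ih =>
    obtain ⟨u, hr, hu⟩ := h
    exact (ih hu).of_arrow hr

lemma exists_descends {v : V} (h : G.InAn Z v) : ∃ m, G.Descends Z m v := by
  rcases h with h | ⟨z, hz, h⟩
  · exact ⟨0, h⟩
  · induction h using Relation.TransGen.head_induction_on with
    | single hr => exact ⟨1, z, hr, hz⟩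
    | head hr _ ih =>
      obtain ⟨m, hm⟩ := ih
      exact ⟨m + 1, _, hr, hm⟩

/-- A shortest directed path of `G` to `Z` whose first arrow is in `H` is a directed path
of `H`. -/
lemma inAn_of_descends (hs : G.skeleton = H.skeleton) (hGH : SameDiscriminated G H) {m : ℕ}
    {v u : V} (hG : G.arrow v u) (hH : H.arrow v u) (hu : G.Descends Z m u)
    (hv : ∀ m' ≤ m, ¬ G.Descends Z m' v) : H.InAn Z u := by
  induction m generalizing v u with
  | zero => exact Or.inl hu
  | succ m ih =>
    obtain ⟨w, hr, hw⟩ := hu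
    have hanc : G.Anc v w := (Relation.TransGen.single hG).tail hr
    -- Shortness leaves `v, u, w` unshielded, so `u` is a non-collider in H too.
    have hna : ¬ G.skeleton.Adj v w := by
      rintro (h | h | h)
      · exact hv (m + 1) le_rfl ⟨w, h, hw⟩
      · exact G.acyclic _ (hanc.tail h)
      · exact G.ancestral _ _ h hanc
    have hvw : v ≠ w := by
      rintro rfl
      exact G.acyclic _ hanc
    have hiff := hGH.unshielded hvw (Or.inl hG) (Or.inl hr) hna
    have hadj : G.skeleton.Adj w u := Or.inr (Or.inl hr)
    have hrH : H.arrow u w := arrow_of_not_headAt (hs ▸ hadj) fun hh =>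
      not_headAt_of_arrow hr (hiff.2 ⟨Or.inl hH, hh⟩).2
    exact (ih hr hrH hw fun m' hm' hd => hv (m' + 1) (by omega) ⟨u, hG, hd⟩).of_arrow hrH

/-- Non-adjacency of `q (s - 1)` and `u`, or a discriminating path towards `u`, would transfer the
non-collider `q s` to H and, with the head from `q (s - 1)`, force `q s → u` there. -/
lemma exists_prefix_of_not_arrow (hmax : G.IsMaximal) (hs : G.skeleton = H.skeleton)
    (hGH : SameDiscriminated G H) {n s : ℕ} {q : ℕ → V} (h : G.IsMinConn Z n q) (h1 : 1 ≤ s)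
    (hsn : s < n) (hcol : G.IsCollider (q (s - 1)) (q s) (q (s + 1))) {u : V}
    (hG : G.arrow (q s) u) (hH : ¬ H.arrow (q s) u) :
    ∃ l < s, G.HeadAt (q l) u ∧ (1 ≤ l → G.Active Z (q (l - 1)) (q l) u) := by
  have hcolH := (isCollider_iff_of_isMinConn hmax hs hGH h s h1 hsn).1 hcol
  have hadju : G.skeleton.Adj (q s) u := Or.inl hG
  have hns : s - 1 + 1 = s := by omega
  have hnot : ¬ (G.IsCollider (q (s - 1)) (q s) u ↔ H.IsCollider (q (s - 1)) (q s) u) := fun hiff =>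
    hH (arrow_of_not_headAt (hs ▸ hadju.symm) fun hh =>
      not_headAt_of_arrow hG (hiff.2 ⟨hcolH.1, hh⟩).2)
  have hadj : G.skeleton.Adj (q (s - 1)) u := by
    by_contra hna
    refine hnot (hGH.unshielded ?_ hcol.1.adj hadju hna)
    rintro rfl
    exact not_headAt_of_arrow hG hcol.1
  have hhead := headAt_trans hcol.1 hG hadj
  rcases exists_prefix_or_discriminating h.toIsConn u (s - 1) (by omega) hhead
    (fun hr harc => by
      rw [hns] at hr
      exact absurd ((Relation.TransGen.single hr).tail hG) (G.ancestral _ _ harc))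
    with ⟨l, hl, hl'⟩ | ⟨m, hm1, hm, hk, hn⟩
  · exact ⟨l, by omega, hl'⟩
  · refine (hnot (hGH.segment hs hm1 (by omega) (fun k l hkl hl => h.ne hkl (by omega))
      (fun k hmk hks => ?_) (fun k hk => h.adj k (by omega)) hadju hn
      (fun k h2 h3 => (hk k h2 (by omega)).1) (fun k h2 h3 =>
        (isCollider_iff_of_isMinConn hmax hs hGH h k (by omega) (by omega)).1
          (hk k h2 (by omega)).1) fun k h2 h3 => (hk k h2 (by omega)).2)).elim
    rcases eq_or_lt_of_le hks with rfl | hks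
    · exact hadju.ne
    · rcases eq_or_lt_of_le hmk with rfl | hmk
      · rintro rfl
        exact not_headAt_of_arrow (hk m le_rfl hm).2 (hk m le_rfl hm).1.1
      · rintro rfl
        exact G.arrow_irrefl _ (hk k (by omega) (by omega)).2

/-- The colliders of a minimal connecting sequence of `G` are active in `H`. -/
lemma inAn_of_isMinConn [Finite V] (hmax : G.IsMaximal) (hs : G.skeleton = H.skeleton)
    (hGH : SameDiscriminated G H) {n s : ℕ} {q : ℕ → V} (h : G.IsMinConn Z n q) (h1 : 1 ≤ s)
    (hsn : s < n) (hcol : G.IsCollider (q (s - 1)) (q s) (q (s + 1))) : H.InAn Z (q s) := by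
  classical
  have hact := h.active (s - 1) (by omega)
  rw [show s - 1 + 1 = s by omega, show s - 1 + 2 = s + 1 by omega] at hact
  have hex := exists_descends (hact.1 hcol)
  have hspec := Nat.find_spec hex
  have hmin : ∀ m', m' < Nat.find hex → ¬ G.Descends Z m' (q s) := fun m' => Nat.find_min hex
  generalize Nat.find hex = m at hspec hmin
  rcases m with _ | m
  · exact Or.inl hspec
  obtain ⟨u, hG, hu⟩ := hspec
  by_cases hH : H.arrow (q s) u
  · exact (inAn_of_descends hs hGH hG hH hu fun m' hm' => hmin m' (by omega)).of_arrow hH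
  -- Both sides of the sequence can be attached to `u`, which becomes an active collider. It
  -- replaces the nodes strictly between `q l` and `q (r + 1)`; these include `q s`, whose rank is
  -- larger.
  obtain ⟨l, hls, hlu, hl⟩ := exists_prefix_of_not_arrow hmax hs hGH h h1 hsn hcol hG hH
  obtain ⟨r', hrs, hru, hr⟩ := exists_prefix_of_not_arrow hmax hs hGH h.reverse (s := n - s) (u := u)
    (by omega) (by omega) (by
      rw [show n - (n - s - 1) = s + 1 by omega, show n - (n - s) = s by omega,
        show n - (n - s + 1) = s - 1 by omega]
      exact hcol.symm) (by rwa [show n - (n - s) = s by omega])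
      (by rwa [show n - (n - s) = s by omega])
  obtain ⟨r, hrn', rfl⟩ : ∃ r, r + 1 ≤ n ∧ r' = n - (r + 1) := ⟨n - r' - 1, by omega, by omega⟩
  rw [show n - (n - (r + 1)) = r + 1 by omega] at hru hr
  have hright : G.IsConn Z (0 + 1 + (n - (r + 1))) (glue (fun _ => u) 0 fun k => q (r + 1 + k)) := by
    refine IsConn.glue ⟨fun k hk => absurd hk (by omega), fun k hk => absurd hk (by omega)⟩
      (h.toIsConn.suffix (by omega)) hru.adj.symm (fun h0 => absurd h0 (by omega)) fun hrn => ?_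
    have := hr hrn
    rw [show n - (n - (r + 1) - 1) = r + 1 + 1 by omega] at this
    exact this.symm
  have e0 : glue (fun _ => u) 0 (fun k => q (r + 1 + k)) 0 = u := glue_left le_rfl
  have e1 : glue (fun _ => u) 0 (fun k => q (r + 1 + k)) 1 = q (r + 1) := glue_right 0
  have hnew := (h.toIsConn.prefix (l := l) (by omega)).glue hright (by rw [e0]; exact hlu.adj)
    (by rwa [e0]) (fun _ => by
      rw [e0, e1]
      exact ⟨fun _ => hu.inAn, fun hn => absurd ⟨hlu, hru⟩ hn⟩)
  have hw := h.min _ _ hnew (glue_left (Nat.zero_le _)) (by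
    rw [glue_right, glue_right]
    exact congrArg q (by omega))
  rw [weight_glue, weight_glue, ← weight_split q (show l ≤ r by omega) (by omega)] at hw
  have h2 := rank_le_sum (G := G.toMixedGraph) q hls (show s ≤ r by omega)
  have h3 := rank_lt_of_anc (.single hG)
  have h4 : G.weight 0 (fun _ => u) = G.rank u := by simp [weight]
  omega

lemma isConn_of_isMinConn [Finite V] (hmax : G.IsMaximal) (hs : G.skeleton = H.skeleton)
    (hGH : SameDiscriminated G H) {n : ℕ} {q : ℕ → V} (h : G.IsMinConn Z n q) :
    H.IsConn Z n q := by
  refine ⟨fun k hk => hs ▸ h.adj k hk, fun k hk => ?_⟩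
  have hiff := isCollider_iff_of_isMinConn hmax hs hGH h (k + 1) (by omega) (by omega)
  exact ⟨fun hc => inAn_of_isMinConn hmax hs hGH h (s := k + 1) (by omega) (by omega) (hiff.2 hc),
    fun hc => (h.active k hk).2 fun hc' => hc (hiff.1 hc')⟩

lemma separated_of_sameDiscriminated [Finite V] (hmax : G.IsMaximal) (hs : G.skeleton = H.skeleton)
    (hGH : SameDiscriminated G H) {A B C : Set V} (h : H.Separated A B C) : G.Separated A B C := by
  rw [separated_iff] at *
  rintro a ha b hb ⟨n, q, hc, rfl, rfl⟩
  obtain ⟨n', q', hm, h0, hn⟩ := hc.exists_min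
  exact h _ ha _ hb ⟨n', q', isConn_of_isMinConn hmax hs hGH hm, h0, hn⟩

/-- Two maximal directed ancestral graphs with the same skeleton and the same discriminated
colliders are Markov equivalent. -/
theorem markovEquivalent_of_sameDiscriminated [Finite V] (hG : G.IsMaximal) (hH : H.IsMaximal)
    (hs : G.skeleton = H.skeleton) (hGH : SameDiscriminated G H) :
    G.MarkovEquivalent H.toMixedGraph := by
  refine IndependenceModel.ext ?_
  funext A B C
  exact propext (and_congr_right fun _ =>
    ⟨separated_of_sameDiscriminated hH hs.symm (hGH.symm hs),
      separated_of_sameDiscriminated hG hs hGH⟩)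

end DirectedAncestralGraph

/-! ### From disagreement of graphs to instability of the model -/

namespace IndependenceModel

open MixedGraph DirectedAncestralGraph

variable {V : Type*} {J : IndependenceModel V} {G H : DirectedAncestralGraph V}

lemma Indep.notMem {i j : V} {C : Set V} (h : J.Indep {i} {j} C) : i ∉ C ∧ j ∉ C := by
  obtain ⟨-, h1, h2⟩ := J.disjoint _ _ _ h
  exact ⟨Set.disjoint_singleton_left.1 h1, Set.disjoint_singleton_left.1 h2⟩

lemma exists_indep_of_not_adj {i j : V} (hij : i ≠ j) (h : ¬ J.skeleton.Adj i j) :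
    ∃ C, J.Indep {i} {j} C := by
  by_contra hn
  refine h ((SimpleGraph.fromRel_adj _ _ _).2 ⟨hij, Or.inl ?_⟩)
  rintro ⟨C, -, -, hC⟩
  exact hn ⟨C, hC⟩

/-- The ancestors of `i` and `j`, other than `i` and `j`. -/
def ancestors (G : DirectedAncestralGraph V) (i j : V) : Set V :=
  {v | (G.Anc v i ∨ G.Anc v j) ∧ v ≠ i ∧ v ≠ j}

lemma OrderedUpwardStable.union [Finite V] (h : J.OrderedUpwardStable G.minimalOrder) {i j : V}
    {C : Set V} (hC : J.Indep {i} {j} C) : J.Indep {i} {j} (C ∪ ancestors G i j) := by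
  refine Set.Finite.induction_on_subset (motive := fun S _ => J.Indep {i} {j} (C ∪ S)) _
    (Set.toFinite _) (by simpa using hC) fun {a S} ha _ _ hS => ?_
  have := h i j _ hS a ha.2.1 ha.2.2 ha.1
  rwa [Set.union_assoc, Set.union_singleton] at this

lemma OrderedDownwardStable.ancestors [Finite V] (h : J.OrderedDownwardStable G.minimalOrder)
    {i j : V} {C : Set V} (hC : J.Indep {i} {j} C) (hsub : ancestors G i j ⊆ C) :
    J.Indep {i} {j} (ancestors G i j) := by
  induction hn : (C \ IndependenceModel.ancestors G i j).ncard generalizing C with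
  | zero =>
    rw [Set.ncard_eq_zero, Set.sdiff_eq_empty] at hn
    rwa [hsub.antisymm hn]
  | succ n ih =>
    -- A node of least rank may be deleted: a descendant of it in `C` would either have smaller rank
    -- or make it an ancestor of `i` or `j`.
    obtain ⟨k, ⟨hkC, hk⟩, hmin⟩ := Set.exists_min_image (C \ IndependenceModel.ancestors G i j)
      G.rank (Set.toFinite _) (Set.nonempty_of_ncard_ne_zero (by omega))
    have hki : k ≠ i := fun e => hC.notMem.1 (e ▸ hkC)
    have hkj : k ≠ j := fun e => hC.notMem.2 (e ▸ hkC)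
    have hd := h i j C hC k hki hkj (fun ha => hk ⟨Or.inl ha, hki, hkj⟩)
      (fun ha => hk ⟨Or.inr ha, hki, hkj⟩) fun l hl ha => by
        by_cases hlA : l ∈ IndependenceModel.ancestors G i j
        · exact hk ⟨hlA.1.imp (Relation.TransGen.trans ha) (Relation.TransGen.trans ha), hki, hkj⟩
        · exact absurd (hmin l ⟨hl.1, hlA⟩) (rank_lt_of_anc ha).not_ge
    refine ih hd (fun v hv => ⟨hsub hv, fun e => hk (e ▸ hv)⟩) ?_
    rw [show (C \ {k}) \ IndependenceModel.ancestors G i j =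
      (C \ IndependenceModel.ancestors G i j) \ {k} from Set.sdiff_sdiff_comm,
      Set.ncard_sdiff_singleton_of_mem (show k ∈ C \ _ from ⟨hkC, hk⟩), hn]
    rfl

lemma OrderedStableWrt.indep_ancestors [Finite V] (h : J.OrderedStableWrt G) {i j : V} (hij : i ≠ j)
    (hna : ¬ J.skeleton.Adj i j) : J.Indep {i} {j} (ancestors G i j) := by
  obtain ⟨C, hC⟩ := exists_indep_of_not_adj hij hna
  exact h.2.ancestors (h.1.union hC) Set.subset_union_right

/-- If the last inner node of a discriminating path is a collider in `G` but not in `H`, then the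
model has an independence statement both with and without that node. -/
lemma OrderedStableWrt.exists_unstable [Finite V] (hG : G.IsMaximal) (hGJ : G.skeleton = J.skeleton)
    (hGst : J.OrderedStableWrt G) (hHJ : H.skeleton = J.skeleton) (hHst : J.OrderedStableWrt H)
    {q : ℕ → V} {n : ℕ} {j : V} (hn : 1 ≤ n) (hinj : ∀ k l, k < l → l ≤ n → q k ≠ q l)
    (hj : ∀ k ≤ n, q k ≠ j) (hadj : ∀ k < n, G.skeleton.Adj (q k) (q (k + 1)))
    (hadjj : ∀ k, 1 ≤ k → k ≤ n → G.skeleton.Adj (q k) j) (hna : ¬ G.skeleton.Adj (q 0) j)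
    (hk : ∀ k, 1 ≤ k → k < n → G.IsCollider (q (k - 1)) (q k) (q (k + 1)) ∧
      G.arrow (q k) j ∧ H.arrow (q k) j)
    (hcG : G.IsCollider (q (n - 1)) (q n) j) (hcH : ¬ H.IsCollider (q (n - 1)) (q n) j) :
    ∃ A, (∀ k, 1 ≤ k → k < n → q k ∈ A) ∧ q 0 ∉ A ∧ j ∉ A ∧ q n ∉ A ∧ J.Indep {q 0} {j} A ∧
      J.Indep {q 0} {j} (A ∪ {q n}) := by
  have h0j := hj 0 (Nat.zero_le _)
  have hA := hGst.indep_ancestors h0j (hGJ ▸ hna)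
  refine ⟨ancestors G (q 0) j, fun k h1 h2 => ⟨Or.inr (.single (hk k h1 h2).2.1), (hinj 0 k h1 h2.le).symm,
    hj k h2.le⟩, hA.notMem.1, hA.notMem.2, fun hmem => hna ?_, hA,
    hHst.1 _ _ _ hA _ (hinj 0 n hn le_rfl).symm (hj n le_rfl) ?_⟩
  · have eq : ∀ k ≤ n, glue q n (fun _ => j) k = q k := fun k hk => glue_left hk
    have ej : glue q n (fun _ => j) (n + 1) = j := glue_right 0
    have := adj_of_inducing hG (q := glue q n fun _ => j) (n := n + 1)
      (by rwa [ej, eq 0 (Nat.zero_le _)]) (fun k hkn => ?_) (fun k h1 hkn => ?_) fun k h1 hkn => ?_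
    · rwa [ej, eq 0 (Nat.zero_le _)] at this
    all_goals rcases eq_or_lt_of_le (Nat.lt_succ_iff.mp hkn) with rfl | hkn
    · rw [ej, eq k le_rfl]
      exact hadjj k hn le_rfl
    · rw [eq k hkn.le, eq (k + 1) hkn]
      exact hadj k hkn
    · rw [ej, eq k le_rfl, eq (k - 1) (by omega)]
      exact hcG
    · rw [eq k hkn.le, eq (k + 1) hkn, eq (k - 1) (by omega)]
      exact (hk k h1 hkn).1
    · rw [ej, eq k le_rfl, eq 0 (Nat.zero_le _)]
      exact hmem.1
    · rw [ej, eq k hkn.le]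
      exact Or.inr (.single (hk k h1 hkn).2.1)
  -- A non-collider of H points to `j` or to `q (n - 1)`, which is `q 0` if `n = 1` and a parent of
  -- `j` otherwise.
  · rw [hGJ, ← hHJ] at hadj hadjj
    by_cases hh : H.HeadAt j (q n)
    · have hlast := hadj (n - 1) (by omega)
      rw [show n - 1 + 1 = n by omega] at hlast
      have hr := arrow_of_not_headAt hlast fun hh' => hcH ⟨hh', hh⟩
      rcases eq_or_lt_of_le hn with rfl | hn
      · exact Or.inl (.single hr)
      · exact Or.inr ((Relation.TransGen.single hr).tail (hk (n - 1) (by omega) (by omega)).2.2)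
    · exact Or.inr (.single (arrow_of_not_headAt (hadjj n hn le_rfl).symm hh))

/-- With `U` the set of nodes strictly between `q 0` and `q n`, the set `C` of the definition is `A
∖ U`. -/
lemma pathUnstable_of_sequence {q : ℕ → V} {n : ℕ} {j : V} (hn : 1 ≤ n)
    (hinj : ∀ k l, k < l → l ≤ n → q k ≠ q l) (hj : ∀ k ≤ n, q k ≠ j)
    (hadj : ∀ k < n, J.skeleton.Adj (q k) (q (k + 1)))
    (hadjj : ∀ k, 1 ≤ k → k ≤ n → J.skeleton.Adj (q k) j) (hna : ¬ J.skeleton.Adj (q 0) j)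
    {A : Set V} (hU : ∀ k, 1 ≤ k → k < n → q k ∈ A) (hi : q 0 ∉ A) (hjA : j ∉ A) (hk : q n ∉ A)
    (hA : J.Indep {q 0} {j} A) (hAk : J.Indep {q 0} {j} (A ∪ {q n})) : J.PathUnstable := by
  obtain ⟨t, rfl⟩ : ∃ t, n = t + 1 := ⟨n - 1, by omega⟩
  obtain ⟨p, hp⟩ := SimpleGraph.exists_walk_of_adj hadj
  have hU' : {u | u ∈ (List.range t).map fun k => q (k + 1)} ∪
      A \ {u | u ∈ (List.range t).map fun k => q (k + 1)} = A := by
    refine Set.union_sdiff_cancel fun u hu => ?_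
    obtain ⟨k, hk, rfl⟩ := List.mem_map.1 hu
    exact hU (k + 1) (by omega) (by have := List.mem_range.1 hk; omega)
  have hsupp : (p.concat (hadjj (t + 1) hn le_rfl)).support = (List.range (t + 2)).map q ++ [j] := by
    rw [SimpleGraph.Walk.support_concat, hp]
  refine ⟨q 0, q (t + 1), j, (List.range t).map fun k => q (k + 1),
    p.concat (hadjj (t + 1) hn le_rfl), ?_, ?_, hna, fun u hu => ?_,
    A \ {u | u ∈ (List.range t).map fun k => q (k + 1)}, fun h => hi h.1, fun h => hjA h.1,
    fun h => hk h.1, by rwa [hU'], by rwa [hU']⟩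
  · rw [SimpleGraph.Walk.isPath_def, hsupp, List.nodup_append]
    refine ⟨List.Nodup.map_on (fun x hx y hy hxy => ?_) List.nodup_range, by simp,
      fun a ha b hb => ?_⟩
    · rw [List.mem_range] at hx hy
      rcases lt_trichotomy x y with hlt | heq | hlt
      · exact absurd hxy (hinj _ _ hlt (by omega))
      · exact heq
      · exact absurd hxy.symm (hinj _ _ hlt (by omega))
    · obtain ⟨k, hk, rfl⟩ := List.mem_map.1 ha
      rw [List.mem_singleton.1 hb]
      exact hj k (by have := List.mem_range.1 hk; omega)
  · rw [hsupp, List.range_succ, List.range_succ_eq_map]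
    simp [Function.comp_def]
  · obtain ⟨k, hk, rfl⟩ := List.mem_map.1 hu
    exact hadjj (k + 1) (by omega) (by have := List.mem_range.1 hk; omega)

theorem PathStable.sameDiscriminated [Finite V] (hJ : J.PathStable) (hG : G.IsMaximal)
    (hGJ : G.skeleton = J.skeleton) (hGst : J.OrderedStableWrt G) (hH : H.IsMaximal)
    (hHJ : H.skeleton = J.skeleton) (hHst : J.OrderedStableWrt H) : SameDiscriminated G H := by
  intro q n j hn hinj hj hadj hadjj hna hk
  constructor
  · intro hc
    by_contra hc'
    obtain ⟨A, hU, hi, hjA, hkA, hA, hAk⟩ := hGst.exists_unstable hG hGJ hHJ hHst hn hinj hj hadj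
      hadjj hna (fun k h1 h2 => ⟨(hk k h1 h2).1, (hk k h1 h2).2.2⟩) hc hc'
    rw [hGJ] at hadj hadjj hna
    exact hJ (pathUnstable_of_sequence hn hinj hj hadj hadjj hna hU hi hjA hkA hA hAk)
  · intro hc
    by_contra hc'
    rw [hGJ, ← hHJ] at hadj hadjj hna
    obtain ⟨A, hU, hi, hjA, hkA, hA, hAk⟩ := hHst.exists_unstable hH hHJ hGJ hGst hn hinj hj hadj
      hadjj hna (fun k h1 h2 => ⟨(hk k h1 h2).2.1, (hk k h1 h2).2.2.symm⟩) hc hc'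
    rw [hHJ] at hadj hadjj hna
    exact hJ (pathUnstable_of_sequence hn hinj hj hadj hadjj hna hU hi hjA hkA hA hAk)

/-- In a DAG the last inner node of a discriminating path is not a collider. -/
lemma _root_.DirectedAncestralGraph.IsDAG.not_isCollider (hG : G.IsDAG) {a b c j : V}
    (h : G.IsCollider a b c) (hr : G.arrow b j) : ¬ G.IsCollider b c j := fun hc =>
  not_anc_of_headAt hc.2 ((Relation.TransGen.single (h.2.resolve_right (hG _ _))).tail hr)

theorem VStable.sameDiscriminated [Finite V] (hJ : J.VStable) (hGd : G.IsDAG) (hHd : H.IsDAG)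
    (hG : G.IsMaximal) (hGJ : G.skeleton = J.skeleton) (hGst : J.OrderedStableWrt G)
    (hH : H.IsMaximal) (hHJ : H.skeleton = J.skeleton) (hHst : J.OrderedStableWrt H) :
    SameDiscriminated G H := by
  intro q n j hn hinj hj hadj hadjj hna hk
  rcases eq_or_lt_of_le hn with rfl | hn'
  · have hV : ∀ A : Set V, q 0 ∉ A → j ∉ A → q 1 ∉ A → J.Indep {q 0} {j} A →
        J.Indep {q 0} {j} (A ∪ {q 1}) → False := fun A hi hjA hkA hA hAk => by
      rw [hGJ] at hadj hadjj hna
      exact hJ ⟨q 0, q 1, j, hj 0 (Nat.zero_le _), hadj 0 one_pos, hadjj 1 le_rfl le_rfl, hna, A,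
        hi, hjA, hkA, hA, hAk⟩
    constructor
    · intro hc
      by_contra hc'
      obtain ⟨A, -, hi, hjA, hkA, hA, hAk⟩ := hGst.exists_unstable hG hGJ hHJ hHst hn hinj hj hadj
        hadjj hna (fun k h1 h2 => by omega) hc hc'
      exact hV A hi hjA hkA hA hAk
    · intro hc
      by_contra hc'
      obtain ⟨A, -, hi, hjA, hkA, hA, hAk⟩ := hHst.exists_unstable hH hHJ hGJ hGst hn hinj hj
        (by rwa [hHJ, ← hGJ]) (by rwa [hHJ, ← hGJ]) (by rwa [hHJ, ← hGJ])
        (fun k h1 h2 => by omega) hc hc'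
      exact hV A hi hjA hkA hA hAk
  · obtain ⟨hcG, hcH, hrG, hrH⟩ := hk (n - 1) (by omega) (by omega)
    rw [show n - 1 + 1 = n by omega] at hcG hcH
    exact iff_of_false (hGd.not_isCollider hcG hrG) (hHd.not_isCollider hcH hrH)

theorem PathStable.uniquenessProperty [Finite V] (hJ : J.PathStable) : J.UniquenessProperty :=
  fun _ _ hG hGJ hGst hH hHJ hHst => markovEquivalent_of_sameDiscriminated hG hH
    (hGJ.trans hHJ.symm) (hJ.sameDiscriminated hG hGJ hGst hH hHJ hHst)

theorem VStable.dagUniquenessProperty [Finite V] (hJ : J.VStable) : J.DAGUniquenessProperty :=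
  fun _ _ hGd hHd hG hGJ hGst hH hHJ hHst => markovEquivalent_of_sameDiscriminated hG hH
    (hGJ.trans hHJ.symm) (hJ.sameDiscriminated hGd hHd hG hGJ hGst hH hHJ hHst)

end IndependenceModel

theorem proposition5p8 {V : Type*} [Finite V] :
    (∀ J : IndependenceModel V,
      (J.PathStable → J.UniquenessProperty) ∧ (J.VStable → J.DAGUniquenessProperty)) ∧
    (∀ (X : V → Type*) [∀ v, MeasurableSpace (X v)] (P : MeasureTheory.Measure (∀ v, X v))
      [MeasureTheory.IsProbabilityMeasure P],
      ((distributionModel P).PathStable → (distributionModel P).UniquenessProperty) ∧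
      ((distributionModel P).VStable → (distributionModel P).DAGUniquenessProperty)) :=
  ⟨fun _ => ⟨fun h => h.uniquenessProperty, fun h => h.dagUniquenessProperty⟩,
    fun _ _ _ _ => ⟨fun h => h.uniquenessProperty, fun h => h.dagUniquenessProperty⟩⟩
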